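/- For $f\in L^2(\mathbb{R})$ (complex valued) let $$V_\varphi f(x,y):=\int_{\mathbb{R}} f(t)\,\varphi(t-x)\,e^{-2\pi i t y}\,dt,\qquad \varphi(t)=e^{-\pi t^2},\quad (x,y)\in\mathbb{R}^2,$$ be its Gabor transform, which satisfies $|V_\varphi f|\in L^2(\mathbb{R}^2)$. Let $L^2(\mathbb{R})/S^1$ be the quotient of $L^2(\mathbb{R})$ by multiplication by the scalars $\tau\in S^1=\{z\in\mathbb{C}: |z|=1\}$, with the metric $$\operatorname{dist}([f],[g])=\inf_{\tau\in S^1}\|f-\tau g\|_{L^2(\mathbb{R})},$$ and let $L^2(\mathbb{R}^2,\mathbb{R}_0^+)$ be the set of (almost everywhere) nonnegative functions in $L^2(\mathbb{R}^2)$, with the $L^2$ metric. Then the Gabor phase retrieval operator $$\mathcal{A}_\varphi: L^2(\mathbb{R})/S^1\to L^2(\mathbb{R}^2,\mathbb{R}_0^+),\qquad [f]\mapsto |V_\varphi f|,$$ has the following properties. 1. $\mathcal{A}_\varphi$ is injective. 2. $\mathcal{A}_\varphi$ is weakly sequentially closed: if $f_n\in L^2(\mathbb{R})$ converges weakly in $L^2(\mathbb{R})$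 to $f$, and $|V_\varphi f_n|$ converges weakly in $L^2(\mathbb{R}^2)$ to some $v\in L^2(\mathbb{R}^2,\mathbb{R}_0^+)$, then $|V_\varphi f|=v$ almost everywhere. 3. The range $\mathcal{R}(\mathcal{A}_\varphi)$ is closed in $L^2(\mathbb{R}^2)$. 4. The inverse $\mathcal{A}_\varphi^{-1}:\mathcal{R}(\mathcal{A}_\varphi)\to L^2(\mathbb{R})/S^1$ is continuous. -/

import Mathlib

open MeasureTheory Filter Topology FourierTransform SchwartzMap
open scoped ENNReal ContDiff

noncomputable section

namespace GaborPhase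

/-- The complex Hilbert space `L²(ℝ)`. -/
abbrev L2R : Type := Lp ℂ 2 (volume : Measure ℝ)

/-- The real Hilbert space `L²(ℝ², ℝ)`. -/
abbrev L2R2 : Type := Lp ℝ 2 (volume : Measure (ℝ × ℝ))

/-- `L²(ℝ², ℝ₀⁺)`: the (almost everywhere) nonnegative elements of `L²(ℝ², ℝ)`, with the metric
inherited from `L²(ℝ², ℝ)`. -/
abbrev NonnegL2R2 : Type := {v : L2R2 // 0 ≤ v}

/-- The Gaussian window `φ(t) = exp (-π t²)`. -/
def gaussWindow (t : ℝ) : ℝ := Real.exp (-Real.pi * t ^ 2)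

/-- The Gabor transform `V_φ f (x, y) = ∫ f(t) φ(t - x) exp (-2 π i t y) dt`. -/
def gaborTransform (f : ℝ → ℂ) (p : ℝ × ℝ) : ℂ :=
  ∫ t : ℝ, f t * (gaussWindow (t - p.1) : ℂ) * Complex.exp (-2 * Real.pi * Complex.I * t * p.2)

/-! ### The Gabor transform magnitude of an `L²` function is an `L²` function -/

/-- On `L¹ ∩ L²`, the Fourier integral is square integrable with the same `L²` norm. -/
theorem eLpNorm_fourier_eq {h : ℝ → ℂ} (h1 : Integrable h) (h2 : MemLp h 2) :
    eLpNorm (𝓕 h) 2 volume = eLpNorm h 2 volume := by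
  have hcont : Continuous (𝓕 h) :=
    VectorFourier.fourierIntegral_continuous Real.continuous_fourierChar
      (by exact continuous_inner) h1
  have hae : 𝓕 h =ᵐ[volume] ((𝓕 (h2.toLp h) : L2R) : ℝ → ℂ) := by
    apply ae_eq_of_integral_contDiff_smul_eq
    · exact hcont.locallyIntegrable
    · exact (Lp.memLp _).locallyIntegrable (by norm_num)
    · intro g g_smooth g_cpt
      have hg₁ : HasCompactSupport (Complex.ofRealCLM ∘ g) := g_cpt.comp_left rfl
      have hg₂ : ContDiff ℝ ∞ (Complex.ofRealCLM ∘ g) := by fun_prop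
      set G : 𝓢(ℝ, ℂ) := hg₁.toSchwartzMap hg₂ with hG
      have e1 := DFunLike.congr_fun
        (MeasureTheory.Lp.fourier_toTemperedDistribution_eq (h2.toLp h)) G
      rw [TemperedDistribution.fourier_apply, Lp.toTemperedDistribution_apply,
        Lp.toTemperedDistribution_apply] at e1
      have e2 : ∫ x, (𝓕 G) x • (h2.toLp h) x = ∫ x, (𝓕 (G : ℝ → ℂ)) x • h x := by
        apply integral_congr_ae
        filter_upwards [h2.coeFn_toLp] with x hx
        rw [hx, SchwartzMap.fourier_coe]
      have e3 : ∫ x, (𝓕 (G : ℝ → ℂ)) x • h x = ∫ x, G x • 𝓕 h x := by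
        have := VectorFourier.integral_fourierIntegral_smul_eq_flip (μ := volume) (ν := volume)
          (L := innerₗ ℝ) (f := (G : ℝ → ℂ)) (g := h) Real.continuous_fourierChar
          (by exact continuous_inner) G.integrable h1
        rw [flip_innerₗ] at this
        exact this
      have e4 : ∀ k : ℝ → ℂ, ∫ x, g x • k x = ∫ x, G x • k x := by
        intro k; congr 1
      rw [e4, e4, ← e1, e2, e3]
  rw [eLpNorm_congr_ae hae]
  have := Lp.norm_fourier_eq (h2.toLp h)
  rw [Lp.norm_def, Lp.norm_def, ENNReal.toReal_eq_toReal_iff' (Lp.eLpNorm_ne_top _)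
    (Lp.eLpNorm_ne_top _)] at this
  rw [this, eLpNorm_congr_ae h2.coeFn_toLp]

theorem continuous_gaussWindow : Continuous gaussWindow := by
  unfold gaussWindow; fun_prop

theorem gaussWindow_sq (t : ℝ) : gaussWindow t ^ 2 = Real.exp (-(2 * Real.pi) * t ^ 2) := by
  rw [gaussWindow, ← Real.exp_nat_mul]; congr 1; push_cast; ring

theorem gaussWindow_nonneg (t : ℝ) : 0 ≤ gaussWindow t := (Real.exp_pos _).le

theorem gaussWindow_le_one (t : ℝ) : gaussWindow t ≤ 1 := by
  apply Real.exp_le_one_iff.2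
  have := Real.pi_pos
  nlinarith [sq_nonneg t, mul_nonneg this.le (sq_nonneg t)]

theorem memLp_gaussWindow : MemLp (fun t => (gaussWindow t : ℂ)) 2 volume := by
  have hm : AEStronglyMeasurable (fun t => (gaussWindow t : ℂ)) (volume : Measure ℝ) :=
    (Complex.continuous_ofReal.comp continuous_gaussWindow).aestronglyMeasurable
  rw [memLp_two_iff_integrable_sq_norm hm]
  have : (fun t => ‖(gaussWindow t : ℂ)‖ ^ 2) = fun t => Real.exp (-(2 * Real.pi) * t ^ 2) := by
    funext t
    rw [Complex.norm_real, Real.norm_eq_abs, sq_abs, gaussWindow_sq]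
  rw [this]
  exact integrable_exp_neg_mul_sq (by positivity)

theorem memLp_gaussWindow_sub (x : ℝ) : MemLp (fun t => (gaussWindow (t - x) : ℂ)) 2 volume :=
  memLp_gaussWindow.comp_measurePreserving (measurePreserving_sub_right volume x)

theorem gaborTransform_eq_fourier (f : ℝ → ℂ) (p : ℝ × ℝ) :
    gaborTransform f p = 𝓕 (fun t => f t * (gaussWindow (t - p.1) : ℂ)) p.2 := by
  rw [Real.fourier_real_eq_integral_exp_smul, gaborTransform]
  congr 1; funext t
  rw [smul_eq_mul, mul_comm]
  congr 2
  push_cast; ring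

theorem memLp_mul_window (f : L2R) (x : ℝ) :
    MemLp (fun t => f t * (gaussWindow (t - x) : ℂ)) 2 volume := by
  refine (Lp.memLp f).mono ?_ (Eventually.of_forall fun t => ?_)
  · exact (Lp.aestronglyMeasurable f).mul (memLp_gaussWindow_sub x).1
  · rw [norm_mul, Complex.norm_real, Real.norm_eq_abs, abs_of_nonneg (gaussWindow_nonneg _)]
    exact mul_le_of_le_one_right (norm_nonneg _) (gaussWindow_le_one _)

theorem integrable_mul_window (f : L2R) (x : ℝ) :
    Integrable (fun t => f t * (gaussWindow (t - x) : ℂ)) volume :=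
  (Lp.memLp f).integrable_mul (memLp_gaussWindow_sub x)

theorem aestronglyMeasurable_gaborTransform (f : L2R) :
    AEStronglyMeasurable (gaborTransform f) (volume : Measure (ℝ × ℝ)) := by
  apply StronglyMeasurable.aestronglyMeasurable
  apply StronglyMeasurable.integral_prod_right'
    (f := fun q : (ℝ × ℝ) × ℝ => f q.2 * (gaussWindow (q.2 - q.1.1) : ℂ) *
      Complex.exp (-2 * Real.pi * Complex.I * q.2 * q.1.2))
  refine StronglyMeasurable.mul (StronglyMeasurable.mul ?_ ?_) ?_
  · exact (Lp.stronglyMeasurable f).comp_measurable measurable_snd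
  · refine Continuous.stronglyMeasurable (Complex.continuous_ofReal.comp
      (continuous_gaussWindow.comp ?_))
    fun_prop
  · refine Continuous.stronglyMeasurable ?_
    fun_prop

theorem lintegral_sq_of_eLpNorm (h : ℝ → ℂ) :
    eLpNorm h 2 volume ^ 2 = ∫⁻ t, ‖h t‖ₑ ^ 2 := by
  have := eLpNorm_nnreal_pow_eq_lintegral (f := h) (μ := volume) (p := 2) (by norm_num)
  simpa using this

theorem memLp_gaborTransform (f : L2R) :
    MemLp (gaborTransform f) 2 (volume : Measure (ℝ × ℝ)) := by
  have hm := aestronglyMeasurable_gaborTransform f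
  refine ⟨hm, ?_⟩
  rw [eLpNorm_lt_top_iff_lintegral_rpow_enorm_lt_top (by norm_num) (by norm_num)]
  simp only [ENNReal.toReal_ofNat, ENNReal.rpow_ofNat]
  rw [Measure.volume_eq_prod] at hm ⊢
  rw [lintegral_prod _ (hm.enorm.pow_const 2)]
  have step : ∀ x : ℝ, ∫⁻ y, ‖gaborTransform f (x, y)‖ₑ ^ 2 =
      ∫⁻ t, ‖f t‖ₑ ^ 2 * ‖(gaussWindow (t - x) : ℂ)‖ₑ ^ 2 := by
    intro x
    simp only [gaborTransform_eq_fourier]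
    rw [← lintegral_sq_of_eLpNorm (𝓕 fun t => f t * (gaussWindow (t - x) : ℂ)),
      eLpNorm_fourier_eq (integrable_mul_window f x) (memLp_mul_window f x),
      lintegral_sq_of_eLpNorm]
    simp only [enorm_mul, mul_pow]
  simp only [step]
  have hmeas : AEMeasurable (Function.uncurry fun x t : ℝ =>
      ‖f t‖ₑ ^ 2 * ‖(gaussWindow (t - x) : ℂ)‖ₑ ^ 2) (volume.prod volume) := by
    apply Measurable.aemeasurable
    refine Measurable.mul (f := fun q : ℝ × ℝ => ‖f q.2‖ₑ ^ 2)
      (g := fun q : ℝ × ℝ => ‖(gaussWindow (q.2 - q.1) : ℂ)‖ₑ ^ 2) ?_ ?_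
    · exact (((Lp.stronglyMeasurable f).measurable.comp measurable_snd).enorm).pow_const 2
    · refine Measurable.pow_const (Measurable.enorm (Continuous.measurable
        (Complex.continuous_ofReal.comp (continuous_gaussWindow.comp ?_)))) 2
      fun_prop
  rw [lintegral_lintegral_swap hmeas]
  have inner : ∀ t : ℝ, ∫⁻ x, ‖f t‖ₑ ^ 2 * ‖(gaussWindow (t - x) : ℂ)‖ₑ ^ 2 =
      ‖f t‖ₑ ^ 2 * ∫⁻ s, ‖(gaussWindow s : ℂ)‖ₑ ^ 2 := by
    intro t
    rw [lintegral_const_mul']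
    · rw [lintegral_sub_left_eq_self (fun s => ‖(gaussWindow s : ℂ)‖ₑ ^ 2) t]
    · exact ENNReal.pow_ne_top enorm_ne_top
  simp only [inner]
  rw [← lintegral_sq_of_eLpNorm (fun s => (gaussWindow s : ℂ)), lintegral_mul_const',
    ← lintegral_sq_of_eLpNorm]
  · exact ENNReal.mul_lt_top (ENNReal.pow_lt_top (Lp.eLpNorm_lt_top f))
      (ENNReal.pow_lt_top memLp_gaussWindow.2)
  · exact ENNReal.pow_ne_top memLp_gaussWindow.eLpNorm_ne_top

/-- The function `(x, y) ↦ |V_φ f (x, y)|`, as an element of `L²(ℝ², ℝ₀⁺)`. -/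
def gaborMagnitude (f : L2R) : NonnegL2R2 :=
  ⟨(memLp_gaborTransform f).norm.toLp (fun p => ‖gaborTransform f p‖), by
    rw [← Lp.coeFn_nonneg]
    filter_upwards [(memLp_gaborTransform f).norm.coeFn_toLp] with p hp
    rw [hp]; exact norm_nonneg _⟩

/-! ### The metric space `L²(ℝ)/S¹` -/

/-- `L²(ℝ)/S¹`: the orbits of `L²(ℝ)` under multiplication by complex numbers of modulus one. -/
def L2ModPhase : Type := MulAction.orbitRel.Quotient Circle L2R

/-- The class in `L²(ℝ)/S¹` of an `L²` function. -/
def L2ModPhase.mk (f : L2R) : L2ModPhase := Quotient.mk (MulAction.orbitRel Circle L2R) f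

theorem L2ModPhase.ind {P : L2ModPhase → Prop} (h : ∀ f, P (L2ModPhase.mk f)) (c : L2ModPhase) :
    P c :=
  Quotient.ind h c

/-- `dist (f, g) = inf { ‖f - τ g‖ : |τ| = 1 }` for `f, g ∈ L²(ℝ)`. -/
def phaseDist (f g : L2R) : ℝ := ⨅ τ : Circle, ‖f - τ • g‖

theorem phaseDist_le (f g : L2R) (τ : Circle) : phaseDist f g ≤ ‖f - τ • g‖ :=
  ciInf_le ⟨0, by rintro _ ⟨σ, rfl⟩; exact norm_nonneg _⟩ τ

theorem exists_phaseDist_eq (f g : L2R) : ∃ τ : Circle, phaseDist f g = ‖f - τ • g‖ := by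
  have hc : Continuous fun τ : Circle => ‖f - τ • g‖ := by fun_prop
  obtain ⟨τ, -, hτ⟩ := isCompact_univ.exists_isMinOn Set.univ_nonempty hc.continuousOn
  exact ⟨τ, le_antisymm (phaseDist_le f g τ) (le_ciInf fun σ => hτ (Set.mem_univ σ))⟩

theorem norm_circle_smul (τ : Circle) (f : L2R) : ‖τ • f‖ = ‖f‖ := by
  rw [Circle.smul_def, norm_smul, Circle.norm_coe, one_mul]

theorem phaseDist_comm_le (f g : L2R) : phaseDist g f ≤ phaseDist f g := by
  obtain ⟨τ, hτ⟩ := exists_phaseDist_eq f g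
  rw [hτ]
  refine (phaseDist_le g f τ⁻¹).trans (le_of_eq ?_)
  rw [← norm_circle_smul τ (g - τ⁻¹ • f), smul_sub, smul_inv_smul, norm_sub_rev]

theorem phaseDist_comm (f g : L2R) : phaseDist f g = phaseDist g f :=
  le_antisymm (phaseDist_comm_le g f) (phaseDist_comm_le f g)

theorem phaseDist_triangle (f g h : L2R) : phaseDist f h ≤ phaseDist f g + phaseDist g h := by
  obtain ⟨τ, hτ⟩ := exists_phaseDist_eq f g
  obtain ⟨σ, hσ⟩ := exists_phaseDist_eq g h
  rw [hτ, hσ]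
  refine (phaseDist_le f h (τ * σ)).trans ?_
  rw [← norm_circle_smul τ (g - σ • h), smul_sub, smul_smul]
  exact norm_sub_le_norm_sub_add_norm_sub _ _ _

theorem phaseDist_smul_self (τ : Circle) (f : L2R) : phaseDist (τ • f) f = 0 := by
  refine le_antisymm ((phaseDist_le _ _ τ).trans (by simp)) ?_
  exact Real.iInf_nonneg fun _ => norm_nonneg _

theorem phaseDist_smul_left (τ : Circle) (f g : L2R) : phaseDist (τ • f) g = phaseDist f g := by
  have h1 := phaseDist_triangle (τ • f) f g
  have h2 := phaseDist_triangle f (τ • f) g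
  rw [phaseDist_smul_self] at h1
  rw [phaseDist_comm f (τ • f), phaseDist_smul_self] at h2
  linarith

theorem phaseDist_congr {f f' g g' : L2R} (hf : MulAction.orbitRel Circle L2R f f')
    (hg : MulAction.orbitRel Circle L2R g g') : phaseDist f g = phaseDist f' g' := by
  obtain ⟨τ, rfl⟩ := hf
  obtain ⟨σ, rfl⟩ := hg
  show phaseDist (τ • f') (σ • g') = _
  rw [phaseDist_smul_left, phaseDist_comm, phaseDist_smul_left, phaseDist_comm]

/-- `L²(ℝ)/S¹` with the metric `dist ([f], [g]) = inf { ‖f - τ g‖ : |τ| = 1 }`. -/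
instance : MetricSpace L2ModPhase where
  dist c d := Quotient.liftOn₂ c d phaseDist fun _ _ _ _ hf hg => phaseDist_congr hf hg
  dist_self := by
    refine L2ModPhase.ind fun f => ?_
    have := phaseDist_smul_self 1 f
    rwa [one_smul] at this
  dist_comm := by
    refine L2ModPhase.ind fun f => L2ModPhase.ind fun g => ?_
    exact phaseDist_comm f g
  dist_triangle := by
    refine L2ModPhase.ind fun f => L2ModPhase.ind fun g => L2ModPhase.ind fun h => ?_
    exact phaseDist_triangle f g h
  eq_of_dist_eq_zero := by
    intro c d
    induction c using L2ModPhase.ind with | h f => ?_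
    induction d using L2ModPhase.ind with | h g => ?_
    intro (h : phaseDist f g = 0)
    obtain ⟨τ, hτ⟩ := exists_phaseDist_eq f g
    rw [h, eq_comm, norm_eq_zero, sub_eq_zero] at hτ
    exact Quotient.sound ⟨τ, hτ.symm⟩

/-! ### The Gabor phase retrieval operator -/

theorem gaborMagnitude_congr {f g : L2R} (h : MulAction.orbitRel Circle L2R f g) :
    gaborMagnitude f = gaborMagnitude g := by
  obtain ⟨τ, rfl⟩ := h
  show gaborMagnitude (τ • g) = _
  apply Subtype.ext
  refine MemLp.toLp_congr (memLp_gaborTransform (τ • g)).norm (memLp_gaborTransform g).norm ?_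
  refine Eventually.of_forall fun p => ?_
  have : gaborTransform (τ • g : L2R) p = τ * gaborTransform g p := by
    unfold gaborTransform
    rw [← integral_const_mul]
    apply integral_congr_ae
    filter_upwards [Lp.coeFn_smul (τ : ℂ) g] with t ht
    rw [Circle.smul_def, ht, Pi.smul_apply, smul_eq_mul]
    ring
  show ‖gaborTransform (τ • g : L2R) p‖ = ‖gaborTransform g p‖
  rw [this, norm_mul, Circle.norm_coe, one_mul]

/-- The Gabor phase retrieval operator `L²(ℝ)/S¹ → L²(ℝ², ℝ₀⁺)`, `[f] ↦ |V_φ f|`. -/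
def gaborOperator (c : L2ModPhase) : NonnegL2R2 :=
  Quotient.liftOn c gaborMagnitude fun _ _ h => gaborMagnitude_congr h

/-- The sequence `c n` in `L²(ℝ)/S¹` converges weakly to `c₀`: there are representatives
`f n` of `c n` and `f₀` of `c₀` such that `f n` converges weakly to `f₀` in `L²(ℝ)`. -/
def WeaklyTendsto (c : ℕ → L2ModPhase) (c₀ : L2ModPhase) : Prop :=
  ∃ (f : ℕ → L2R) (f₀ : L2R), (∀ n, L2ModPhase.mk (f n) = c n) ∧ L2ModPhase.mk f₀ = c₀ ∧
    Tendsto (fun n => toWeakSpace ℂ L2R (f n)) atTop (𝓝 (toWeakSpace ℂ L2R f₀))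

/-- Weak sequential closedness: if `c n` converges weakly to `c₀` in `L²(ℝ)/S¹` and `T (c n)`
converges weakly to `v ∈ L²(ℝ², ℝ₀⁺)` in `L²(ℝ²)`, then `T c₀ = v`. -/
def WeaklySeqClosed (T : L2ModPhase → NonnegL2R2) : Prop :=
  ∀ (c : ℕ → L2ModPhase) (c₀ : L2ModPhase) (v : NonnegL2R2), WeaklyTendsto c c₀ →
    Tendsto (fun n => toWeakSpace ℝ L2R2 (T (c n)).1) atTop (𝓝 (toWeakSpace ℝ L2R2 v.1)) →
    T c₀ = v

end GaborPhase

end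

namespace GaborPhase

/-! ### Energy identity -/

/-! Two independent facts carry the theorem. Injectivity is complex analysis: up to a zero-free
Gaussian factor, the Gabor transform is an entire function, the Bargmann transform, and two entire
functions of equal modulus differ by a unimodular constant (`exists_unimodular_of_norm_eq`). The
rest is weak compactness plus the energy identity `‖V f‖ = ‖f‖ ‖φ‖`. Since `V f p` is an inner
product with a fixed window, weak convergence of `f n` gives bounded pointwise convergence of `V (f
n)`; this identifies weak limits of the magnitudes (`gaborMagnitude_eq_of_tendsto_weakly`). If the
magnitudes converge strongly, the norms of `f n` converge, a subsequence has a weak limit `g`, and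
the energy identity forces `‖f n‖ → ‖g‖`, so the convergence is strong
(`exists_subseq_tendsto_of_tendsto_gaborMagnitude`). Closed range follows, and with injectivity so
does continuity of the inverse. -/

theorem eLpNorm_gaborTransform (f : L2R) :
    eLpNorm (gaborTransform f) 2 (volume : Measure (ℝ × ℝ)) =
      eLpNorm f 2 volume * eLpNorm (fun t => (gaussWindow t : ℂ)) 2 volume := by
  have hm := aestronglyMeasurable_gaborTransform f
  -- Plancherel in `y` for fixed `x`; after Tonelli, translation invariance makes the `x`-integral
  -- of the window independent of `t`.
  have step : ∀ x : ℝ, ∫⁻ y, ‖gaborTransform f (x, y)‖ₑ ^ 2 =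
      ∫⁻ t, ‖f t‖ₑ ^ 2 * ‖(gaussWindow (t - x) : ℂ)‖ₑ ^ 2 := by
    intro x
    simp only [gaborTransform_eq_fourier]
    rw [← lintegral_sq_of_eLpNorm (𝓕 fun t => f t * (gaussWindow (t - x) : ℂ)),
      eLpNorm_fourier_eq (integrable_mul_window f x) (memLp_mul_window f x),
      lintegral_sq_of_eLpNorm]
    simp only [enorm_mul, mul_pow]
  have hmeas : AEMeasurable (Function.uncurry fun x t : ℝ =>
      ‖f t‖ₑ ^ 2 * ‖(gaussWindow (t - x) : ℂ)‖ₑ ^ 2) (volume.prod volume) := by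
    apply Measurable.aemeasurable
    refine Measurable.mul (f := fun q : ℝ × ℝ => ‖f q.2‖ₑ ^ 2)
      (g := fun q : ℝ × ℝ => ‖(gaussWindow (q.2 - q.1) : ℂ)‖ₑ ^ 2) ?_ ?_
    · exact (((Lp.stronglyMeasurable f).measurable.comp measurable_snd).enorm).pow_const 2
    · refine Measurable.pow_const (Measurable.enorm (Continuous.measurable
        (Complex.continuous_ofReal.comp (continuous_gaussWindow.comp ?_)))) 2
      fun_prop
  have inner : ∀ t : ℝ, ∫⁻ x, ‖f t‖ₑ ^ 2 * ‖(gaussWindow (t - x) : ℂ)‖ₑ ^ 2 =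
      ‖f t‖ₑ ^ 2 * ∫⁻ s, ‖(gaussWindow s : ℂ)‖ₑ ^ 2 := by
    intro t
    rw [lintegral_const_mul' _ _ (ENNReal.pow_ne_top enorm_ne_top),
      lintegral_sub_left_eq_self (fun s => ‖(gaussWindow s : ℂ)‖ₑ ^ 2) t]
  have key : eLpNorm (gaborTransform f) 2 (volume : Measure (ℝ × ℝ)) ^ 2 =
      (eLpNorm f 2 volume * eLpNorm (fun t => (gaussWindow t : ℂ)) 2 volume) ^ 2 := by
    have h := eLpNorm_nnreal_pow_eq_lintegral (f := gaborTransform f)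
      (μ := (volume : Measure (ℝ × ℝ))) (p := 2) (by norm_num)
    simp only [NNReal.coe_ofNat, ENNReal.rpow_ofNat, ENNReal.coe_ofNat] at h
    rw [h, Measure.volume_eq_prod]
    rw [Measure.volume_eq_prod] at hm
    rw [lintegral_prod _ (hm.enorm.pow_const 2)]
    simp only [step]
    rw [lintegral_lintegral_swap hmeas]
    simp only [inner]
    rw [lintegral_mul_const', mul_pow, lintegral_sq_of_eLpNorm, lintegral_sq_of_eLpNorm]
    rw [← lintegral_sq_of_eLpNorm]
    exact ENNReal.pow_ne_top memLp_gaussWindow.eLpNorm_ne_top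
  exact (ENNReal.pow_right_strictMono two_ne_zero).injective key

/-- The `L²` norm of the Gaussian window. -/
noncomputable def windowNorm : ℝ := (eLpNorm (fun t => (gaussWindow t : ℂ)) 2 volume).toReal

theorem windowNorm_pos : 0 < windowNorm := by
  refine ENNReal.toReal_pos ?_ memLp_gaussWindow.eLpNorm_ne_top
  intro h
  rw [eLpNorm_eq_zero_iff memLp_gaussWindow.1 two_ne_zero] at h
  have hc : Continuous fun t => (gaussWindow t : ℂ) :=
    Complex.continuous_ofReal.comp continuous_gaussWindow
  have h0 := congrFun ((hc.ae_eq_iff_eq volume continuous_const).1 h) 0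
  exact Complex.ofReal_ne_zero.2 (Real.exp_pos _).ne' h0

theorem norm_gaborMagnitude (f : L2R) : ‖(gaborMagnitude f).1‖ = ‖f‖ * windowNorm := by
  change ‖(memLp_gaborTransform f).norm.toLp _‖ = _
  rw [Lp.norm_toLp, eLpNorm_norm, eLpNorm_gaborTransform, ENNReal.toReal_mul, Lp.norm_def]
  rfl

theorem gaborMagnitude_ae_eq (f : L2R) :
    ((gaborMagnitude f).1 : ℝ × ℝ → ℝ) =ᵐ[volume] fun p => ‖gaborTransform f p‖ :=
  (memLp_gaborTransform f).norm.coeFn_toLp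

/-! ### The Gabor transform is the pairing with the time-frequency shifted window -/

/-- The time-frequency shift of the Gaussian window by `p`. -/
noncomputable def shiftedWindow (p : ℝ × ℝ) (t : ℝ) : ℂ :=
  (gaussWindow (t - p.1) : ℂ) * Complex.exp (2 * Real.pi * Complex.I * t * p.2)

theorem norm_shiftedWindow (p : ℝ × ℝ) (t : ℝ) :
    ‖shiftedWindow p t‖ = ‖(gaussWindow (t - p.1) : ℂ)‖ := by
  have h : (2 * Real.pi * Complex.I * t * p.2 : ℂ) = ((2 * Real.pi * t * p.2 : ℝ) : ℂ) * Complex.I := by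
    push_cast; ring
  rw [shiftedWindow, norm_mul, h, Complex.norm_exp_ofReal_mul_I, mul_one]

theorem continuous_shiftedWindow (p : ℝ × ℝ) : Continuous (shiftedWindow p) := by
  unfold shiftedWindow
  refine (Complex.continuous_ofReal.comp (continuous_gaussWindow.comp ?_)).mul ?_ <;> fun_prop

theorem memLp_shiftedWindow (p : ℝ × ℝ) : MemLp (shiftedWindow p) 2 volume :=
  (memLp_gaussWindow_sub p.1).of_le (continuous_shiftedWindow p).aestronglyMeasurable
    (Eventually.of_forall fun t => (norm_shiftedWindow p t).le)

/-- Makes point evaluation of the transform weakly continuous in `f`. -/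
theorem gaborTransform_eq_inner (f : L2R) (p : ℝ × ℝ) :
    gaborTransform f p = inner ℂ ((memLp_shiftedWindow p).toLp (shiftedWindow p)) f := by
  rw [L2.inner_def, gaborTransform]
  apply integral_congr_ae
  filter_upwards [(memLp_shiftedWindow p).coeFn_toLp] with t ht
  rw [ht, RCLike.inner_apply, shiftedWindow, map_mul, ← Complex.exp_conj, mul_assoc]
  simp [Complex.conj_ofReal, map_ofNat]

theorem norm_shiftedWindow_toLp (p : ℝ × ℝ) :
    ‖(memLp_shiftedWindow p).toLp (shiftedWindow p)‖ = windowNorm := by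
  rw [Lp.norm_toLp, windowNorm, eLpNorm_congr_norm_ae
    (Eventually.of_forall fun t => norm_shiftedWindow p t)]
  congr 1
  exact eLpNorm_comp_measurePreserving (g := fun t => (gaussWindow t : ℂ))
    memLp_gaussWindow.1 (measurePreserving_sub_right volume p.1)

theorem norm_gaborTransform_le (f : L2R) (p : ℝ × ℝ) :
    ‖gaborTransform f p‖ ≤ windowNorm * ‖f‖ := by
  rw [gaborTransform_eq_inner, ← norm_shiftedWindow_toLp p]
  exact norm_inner_le_norm _ _

/-! ### Weak convergence -/

theorem tendsto_toWeakSpace_iff {𝕜 H : Type*} [RCLike 𝕜] [NormedAddCommGroup H]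
    [InnerProductSpace 𝕜 H] [CompleteSpace H] {f : ℕ → H} {g : H} :
    Tendsto (fun n => toWeakSpace 𝕜 H (f n)) atTop (𝓝 (toWeakSpace 𝕜 H g)) ↔
      ∀ h : H, Tendsto (fun n => inner 𝕜 h (f n)) atTop (𝓝 (inner 𝕜 h g)) := by
  have hB : Function.Injective (topDualPairing 𝕜 H).flip := by
    intro x y hxy
    refine ext_inner_left 𝕜 fun h => ?_
    exact DFunLike.congr_fun hxy (innerSL 𝕜 h)
  refine (WeakBilin.tendsto_iff_forall_eval_tendsto _ hB).trans ⟨fun h z => ?_, fun h ℓ => ?_⟩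
  · exact h (innerSL 𝕜 z)
  · have := h ((InnerProductSpace.toDual 𝕜 H).symm ℓ)
    simp only [InnerProductSpace.toDual_symm_apply] at this
    exact this

theorem exists_norm_le_of_tendsto_inner {𝕜 H : Type*} [RCLike 𝕜] [NormedAddCommGroup H]
    [InnerProductSpace 𝕜 H] [CompleteSpace H] {f : ℕ → H} {g : H}
    (h : ∀ z : H, Tendsto (fun n => inner 𝕜 z (f n)) atTop (𝓝 (inner 𝕜 z g))) :
    ∃ C, ∀ n, ‖f n‖ ≤ C := by
  obtain ⟨C, hC⟩ := banach_steinhaus (g := fun n => innerSL 𝕜 (f n)) (fun z => by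
    obtain ⟨C, hC⟩ := (h z).norm.bddAbove_range
    refine ⟨C, fun n => ?_⟩
    rw [innerSL_apply_apply, norm_inner_symm]
    exact hC ⟨n, rfl⟩)
  exact ⟨C, fun n => by simpa using hC n⟩

/-- The transforms converge pointwise and, by Banach–Steinhaus, are uniformly bounded. Constants are
integrable on sets of finite measure, so dominated convergence applies there. -/
theorem gaborMagnitude_eq_of_tendsto_weakly {f : ℕ → L2R} {g : L2R} {v : L2R2}
    (hf : ∀ z : L2R, Tendsto (fun n => inner ℂ z (f n)) atTop (𝓝 (inner ℂ z g)))
    (hv : ∀ w : L2R2, Tendsto (fun n => inner ℝ w (gaborMagnitude (f n)).1) atTop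
      (𝓝 (inner ℝ w v))) :
    (gaborMagnitude g).1 = v := by
  obtain ⟨C, hC⟩ := exists_norm_le_of_tendsto_inner hf
  apply Lp.ext
  refine Lp.ae_eq_of_forall_setIntegral_eq _ _ two_ne_zero ENNReal.ofNat_ne_top
    (fun s _ hs => integrableOn_Lp_of_measure_ne_top _ one_le_two hs.ne)
    (fun s _ hs => integrableOn_Lp_of_measure_ne_top _ one_le_two hs.ne) fun s hs hsμ => ?_
  have h1 : Tendsto (fun n => ∫ p in s, (gaborMagnitude (f n)).1 p) atTop
      (𝓝 (∫ p in s, v p)) := by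
    -- Testing against the indicator of `s` turns weak convergence into convergence of integrals
    -- over `s`.
    have := hv (indicatorConstLp 2 hs hsμ.ne 1)
    simpa only [L2.inner_indicatorConstLp_one] using this
  refine tendsto_nhds_unique ?_ h1
  have e : ∀ h : L2R, ∫ p in s, (gaborMagnitude h).1 p = ∫ p in s, ‖gaborTransform h p‖ :=
    fun h => integral_congr_ae (ae_restrict_of_ae (gaborMagnitude_ae_eq h))
  simp only [e]
  refine tendsto_integral_of_dominated_convergence (fun _ => windowNorm * C)
    (fun n => (aestronglyMeasurable_gaborTransform (f n)).norm.restrict)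
    ?_ (fun n => Eventually.of_forall fun p => ?_) (Eventually.of_forall fun p => ?_)
  · exact integrableOn_const hsμ.ne
  · rw [norm_norm]
    exact (norm_gaborTransform_le _ _).trans
      (mul_le_mul_of_nonneg_left (hC n) windowNorm_pos.le)
  · simp only [gaborTransform_eq_inner]
    exact (hf _).norm

/-- Bounded sequences in a separable Hilbert space have weakly convergent subsequences. -/
theorem exists_subseq_tendsto_inner {𝕜 H : Type*} [RCLike 𝕜] [NormedAddCommGroup H]
    [InnerProductSpace 𝕜 H] [CompleteSpace H] [TopologicalSpace.SeparableSpace H]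
    {f : ℕ → H} {C : ℝ} (hC : ∀ n, ‖f n‖ ≤ C) :
    ∃ (g : H) (φ : ℕ → ℕ), StrictMono φ ∧
      ∀ z : H, Tendsto (fun n => inner 𝕜 z (f (φ n))) atTop (𝓝 (inner 𝕜 z g)) := by
  -- Sequential Banach–Alaoglu in the dual, carried back by the Riesz isomorphism. Riesz puts the
  -- vector in the first slot of the inner product, hence the conjugations below.
  obtain ⟨ℓ, -, φ, hφ, hl⟩ := WeakDual.isSeqCompact_closedBall 𝕜 H 0 C
    (x := fun n => StrongDual.toWeakDual (InnerProductSpace.toDual 𝕜 H (f n))) (fun n => by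
      simpa using hC n)
  refine ⟨(InnerProductSpace.toDual 𝕜 H).symm (WeakDual.toStrongDual ℓ), φ, hφ, fun z => ?_⟩
  have h1 := ((WeakDual.eval_continuous z).tendsto ℓ).comp hl
  have h2 := (RCLike.continuous_conj (K := 𝕜)).tendsto _ |>.comp h1
  rw [← inner_conj_symm z, InnerProductSpace.toDual_symm_apply]
  refine h2.congr fun n => ?_
  exact inner_conj_symm z (f (φ n))

/-- No mass is lost in the weak limit, because the energy identity computes `‖g‖` from `‖v‖`; weak
convergence together with convergence of norms is strong convergence. -/
theorem exists_subseq_tendsto_of_tendsto_gaborMagnitude {f : ℕ → L2R} {v : L2R2}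
    (h : Tendsto (fun n => (gaborMagnitude (f n)).1) atTop (𝓝 v)) :
    ∃ (g : L2R) (φ : ℕ → ℕ), StrictMono φ ∧ Tendsto (fun n => f (φ n)) atTop (𝓝 g) ∧
      (gaborMagnitude g).1 = v := by
  have hnorm : Tendsto (fun n => ‖f n‖) atTop (𝓝 (‖v‖ / windowNorm)) := by
    refine (h.norm.div_const windowNorm).congr fun n => ?_
    rw [norm_gaborMagnitude, mul_div_cancel_right₀ _ windowNorm_pos.ne']
  obtain ⟨C, hC⟩ := hnorm.bddAbove_range
  have : Fact ((2 : ℝ≥0∞) ≠ ⊤) := ⟨ENNReal.ofNat_ne_top⟩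
  obtain ⟨g, φ, hφ, hg⟩ := exists_subseq_tendsto_inner (𝕜 := ℂ) (f := f) (fun n => hC ⟨n, rfl⟩)
  have hgv : (gaborMagnitude g).1 = v :=
    gaborMagnitude_eq_of_tendsto_weakly hg fun w =>
      ((innerSL ℝ w).continuous.tendsto v).comp (h.comp hφ.tendsto_atTop)
  refine ⟨g, φ, hφ, ?_, hgv⟩
  have hng : ‖v‖ / windowNorm = ‖g‖ := by
    rw [← hgv, norm_gaborMagnitude, mul_div_cancel_right₀ _ windowNorm_pos.ne']
  rw [hng] at hnorm
  rw [tendsto_iff_norm_sub_tendsto_zero]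
  have hre : Tendsto (fun n => RCLike.re (inner ℂ g (f (φ n)))) atTop (𝓝 (‖g‖ ^ 2)) := by
    have := (RCLike.continuous_re (K := ℂ)).tendsto _ |>.comp (hg g)
    rwa [inner_self_eq_norm_sq] at this
  have hsq : Tendsto (fun n => ‖f (φ n) - g‖ ^ 2) atTop (𝓝 0) := by
    have := (((hnorm.comp hφ.tendsto_atTop).pow 2).sub (hre.const_mul 2)).add_const (‖g‖ ^ 2)
    rw [show ‖g‖ ^ 2 - 2 * ‖g‖ ^ 2 + ‖g‖ ^ 2 = 0 by ring] at this
    refine this.congr fun n => ?_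
    rw [@norm_sub_sq ℂ, inner_re_symm]
    rfl
  have := hsq.sqrt
  simpa using this


/-! ### The Bargmann transform -/

/-- The integrand of the Bargmann transform. -/
noncomputable def bargmannKernel (z : ℂ) (t : ℝ) : ℂ :=
  Complex.exp (-Real.pi * t ^ 2 + 2 * Real.pi * t * z)

/-- The Bargmann transform `z ↦ ∫ f(t) exp (-π t² + 2 π t z) dt`, up to normalization. -/
noncomputable def bargmann (f : ℝ → ℂ) (z : ℂ) : ℂ := ∫ t : ℝ, f t * bargmannKernel z t

theorem continuous_bargmannKernel (z : ℂ) : Continuous (bargmannKernel z) := by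
  unfold bargmannKernel; fun_prop

/-- Completing the square in `t`; it shows that the kernel is square integrable. -/
theorem norm_bargmannKernel (z : ℂ) (t : ℝ) :
    ‖bargmannKernel z t‖ = Real.exp (Real.pi * z.re ^ 2) * gaussWindow (t - z.re) := by
  have h : (-Real.pi * t ^ 2 + 2 * Real.pi * t * z : ℂ).re =
      -Real.pi * t ^ 2 + 2 * Real.pi * t * z.re := by
    have h1 : (-Real.pi * t ^ 2 + 2 * Real.pi * t * z : ℂ) =
      ((-Real.pi * t ^ 2 : ℝ) : ℂ) + ((2 * Real.pi * t : ℝ) : ℂ) * z := by push_cast; ring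
    rw [h1, Complex.add_re, Complex.ofReal_re, Complex.re_ofReal_mul]
  rw [bargmannKernel, Complex.norm_exp, h, gaussWindow, ← Real.exp_add]
  congr 1; ring

theorem gaborTransform_eq_bargmann (f : ℝ → ℂ) (p : ℝ × ℝ) :
    gaborTransform f p =
      Complex.exp (-Real.pi * p.1 ^ 2) * bargmann f (p.1 - Complex.I * p.2) := by
  rw [gaborTransform, bargmann, ← integral_const_mul]
  congr 1; funext t
  rw [bargmannKernel, gaussWindow, mul_left_comm, ← Complex.exp_add, mul_assoc, Complex.ofReal_exp,
    ← Complex.exp_add]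
  congr 2
  push_cast; ring

theorem memLp_gaussWindow_sub_real (x : ℝ) : MemLp (fun t => gaussWindow (t - x)) 2 volume :=
  (memLp_gaussWindow_sub x).of_le
    (continuous_gaussWindow.comp (continuous_sub_right x)).aestronglyMeasurable
    (Eventually.of_forall fun t => by rw [Complex.norm_real])

theorem integrable_mul_bargmannKernel (f : L2R) (z : ℂ) :
    Integrable (fun t => f t * bargmannKernel z t) volume := by
  refine (Lp.memLp f).integrable_mul
    (((memLp_gaussWindow_sub_real z.re).const_mul (Real.exp (Real.pi * z.re ^ 2))).of_le
      (continuous_bargmannKernel z).aestronglyMeasurable (Eventually.of_forall fun t => ?_))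
  rw [norm_bargmannKernel]
  exact le_abs_self _

/-- Completing the square for either sign of `t` gives exactly one of the two Gaussians; their sum
avoids a case split in the dominating function. -/
theorem exp_mul_abs_mul_gauss_le (R t : ℝ) :
    Real.exp (-Real.pi * t ^ 2 + R * |t|) ≤
      Real.exp (R ^ 2 / (4 * Real.pi)) *
        (gaussWindow (t - R / (2 * Real.pi)) + gaussWindow (t - -(R / (2 * Real.pi)))) := by
  have hπ := Real.pi_pos.ne'
  rw [mul_add, gaussWindow, gaussWindow, ← Real.exp_add, ← Real.exp_add]
  rcases abs_cases t with ⟨h, -⟩ | ⟨h, -⟩ <;> rw [h]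
  · refine le_add_of_le_of_nonneg (le_of_eq ?_) (Real.exp_pos _).le
    congr 1; field_simp; ring
  · refine le_add_of_nonneg_of_le (Real.exp_pos _).le (le_of_eq ?_)
    congr 1; field_simp; ring

theorem hasDerivAt_bargmannKernel (t : ℝ) (z : ℂ) :
    HasDerivAt (fun z => bargmannKernel z t) (bargmannKernel z t * (2 * Real.pi * t)) z := by
  have h : HasDerivAt (fun z : ℂ => (-Real.pi * t ^ 2 + 2 * Real.pi * t * z : ℂ))
      (2 * Real.pi * t) z := by
    simpa using ((hasDerivAt_id z).const_mul (2 * Real.pi * t : ℂ)).const_add (-Real.pi * t ^ 2 : ℂ)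
  exact h.cexp

theorem differentiable_bargmann (f : L2R) : Differentiable ℂ (bargmann f) := by
  intro z₀
  set r : ℝ := |z₀.re| + 1 with hr
  -- `r` bounds `|Re z|` on the unit ball about `z₀`; the extra `2π` absorbs the factor `|t| ≤ exp
  -- (2π|t|)` from differentiating the kernel.
  set R : ℝ := 2 * Real.pi * (r + 1) with hR
  set b : ℝ → ℝ := fun t => Real.exp (R ^ 2 / (4 * Real.pi)) *
        (gaussWindow (t - R / (2 * Real.pi)) + gaussWindow (t - -(R / (2 * Real.pi)))) with hb
  have hb2 : MemLp b 2 volume :=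
    ((memLp_gaussWindow_sub_real _).add (memLp_gaussWindow_sub_real _)).const_mul _
  have hint : Integrable (fun t => ‖f t‖ * b t) volume := (Lp.memLp f).norm.integrable_mul hb2
  refine (hasDerivAt_integral_of_dominated_loc_of_deriv_le (μ := volume)
    (F := fun z t => f t * bargmannKernel z t)
    (F' := fun z t => f t * (bargmannKernel z t * (2 * Real.pi * t)))
    (bound := fun t => 2 * Real.pi * (‖f t‖ * b t))
    (Metric.ball_mem_nhds z₀ one_pos)
    (Eventually.of_forall fun z => (integrable_mul_bargmannKernel f z).1)
    (integrable_mul_bargmannKernel f z₀) ?_ ?_ (hint.const_mul _)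
    (Eventually.of_forall fun t z _ => (hasDerivAt_bargmannKernel t z).const_mul _)).2.differentiableAt
  · exact (Lp.aestronglyMeasurable f).mul
      (((continuous_bargmannKernel z₀).mul (by fun_prop)).aestronglyMeasurable)
  · refine Eventually.of_forall fun t z hz => ?_
    have hzr : |z.re| ≤ r := by
      have h1 : |(z - z₀).re| ≤ 1 :=
        (Complex.abs_re_le_norm _).trans (mem_ball_iff_norm.1 hz).le
      rw [Complex.sub_re] at h1
      have h2 := abs_sub_abs_le_abs_sub z.re z₀.re
      rw [hr]; linarith
    have hn : ‖(2 * Real.pi * t : ℂ)‖ = 2 * Real.pi * |t| := by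
      simp [abs_of_pos Real.pi_pos]
    have hker : ‖bargmannKernel z t‖ ≤ Real.exp (-Real.pi * t ^ 2 + 2 * Real.pi * r * |t|) := by
      rw [norm_bargmannKernel, gaussWindow, ← Real.exp_add]
      apply Real.exp_le_exp.2
      have h3 : t * z.re ≤ |t| * r := (le_abs_self _).trans
        (by rw [abs_mul]; exact mul_le_mul_of_nonneg_left hzr (abs_nonneg t))
      have h4 := mul_le_mul_of_nonneg_left h3 Real.two_pi_pos.le
      nlinarith
    have ht : |t| ≤ Real.exp (2 * Real.pi * |t|) := by
      have h5 := Real.add_one_le_exp (2 * Real.pi * |t|)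
      have h6 : 1 * |t| ≤ 2 * Real.pi * |t| :=
        mul_le_mul_of_nonneg_right (by linarith [Real.pi_gt_three]) (abs_nonneg t)
      linarith
    rw [norm_mul, norm_mul, hn]
    calc ‖f t‖ * (‖bargmannKernel z t‖ * (2 * Real.pi * |t|))
        = 2 * Real.pi * (‖f t‖ * (‖bargmannKernel z t‖ * |t|)) := by ring
      _ ≤ 2 * Real.pi * (‖f t‖ * (Real.exp (-Real.pi * t ^ 2 + 2 * Real.pi * r * |t|) *
            Real.exp (2 * Real.pi * |t|))) := by gcongr
      _ ≤ 2 * Real.pi * (‖f t‖ * b t) := by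
        rw [← Real.exp_add]
        gcongr
        refine le_trans (le_of_eq ?_) (exp_mul_abs_mul_gauss_le R t)
        congr 1; rw [hR]; ring

/-! ### Entire functions with equal moduli -/

/-- Near a point where `G ≠ 0` the quotient `F / G` has constant modulus one, hence is locally
constant by the maximum principle; the identity theorem extends the relation to the plane. -/
theorem exists_unimodular_of_norm_eq {F G : ℂ → ℂ} (hF : Differentiable ℂ F)
    (hG : Differentiable ℂ G) (h : ∀ z, ‖F z‖ = ‖G z‖) : ∃ τ : Circle, ∀ z, F z = τ * G z := by
  by_cases hG0 : ∀ z, G z = 0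
  · exact ⟨1, fun z => by rw [hG0, mul_zero, ← norm_eq_zero, h, hG0, norm_zero]⟩
  · push Not at hG0
    obtain ⟨z₀, hz₀⟩ := hG0
    have hne : ∀ᶠ z in 𝓝 z₀, G z ≠ 0 := hG.continuous.continuousAt.eventually_ne hz₀
    have hn : ∀ z, G z ≠ 0 → ‖F z / G z‖ = 1 := fun z hz => by
      rw [norm_div, h, div_self (norm_ne_zero_iff.2 hz)]
    have hloc : ∀ᶠ z in 𝓝 z₀, F z / G z = F z₀ / G z₀ := by
      refine Complex.eventually_eq_of_isLocalMax_norm (f := fun z => F z / G z) ?_ ?_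
      · exact hne.mono fun z hz => (hF z).div (hG z) hz
      · filter_upwards [hne] with z hz
        simp only [Function.comp_apply, hn z hz, hn z₀ hz₀, le_refl]
    refine ⟨⟨F z₀ / G z₀, mem_sphere_zero_iff_norm.2 (hn z₀ hz₀)⟩, fun z => ?_⟩
    have hev : F =ᶠ[𝓝 z₀] fun z => F z₀ / G z₀ * G z := by
      filter_upwards [hne, hloc] with z hz hz'
      rw [← hz', div_mul_cancel₀ _ hz]
    exact congrFun (AnalyticOnNhd.eq_of_eventuallyEq
      (fun w _ => hF.analyticAt w)
      (fun w _ => (hG.const_mul (F z₀ / G z₀)).analyticAt w) hev) z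

/-! ### Injectivity -/

theorem continuous_gaborTransform (f : L2R) : Continuous (gaborTransform f) := by
  have h : gaborTransform f = fun p : ℝ × ℝ =>
      Complex.exp (-Real.pi * p.1 ^ 2) * bargmann f (p.1 - Complex.I * p.2) :=
    funext (gaborTransform_eq_bargmann f)
  rw [h]
  refine Continuous.mul (by fun_prop) ((differentiable_bargmann f).continuous.comp (by fun_prop))

/-- Equality in `L²` holds only almost everywhere; continuity upgrades it to every point. -/
theorem norm_gaborTransform_eq {f g : L2R} (h : gaborMagnitude f = gaborMagnitude g)
    (p : ℝ × ℝ) : ‖gaborTransform f p‖ = ‖gaborTransform g p‖ := by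
  have h1 : (fun p => ‖gaborTransform f p‖) =ᵐ[volume] fun p => ‖gaborTransform g p‖ := by
    filter_upwards [gaborMagnitude_ae_eq f, gaborMagnitude_ae_eq g] with q hf hg
    rw [← hf, ← hg, h]
  exact congrFun (((continuous_gaborTransform f).norm.ae_eq_iff_eq volume
    (continuous_gaborTransform g).norm).1 h1) p

theorem norm_bargmann_eq {f g : L2R} (h : gaborMagnitude f = gaborMagnitude g) (z : ℂ) :
    ‖bargmann f z‖ = ‖bargmann g z‖ := by
  -- The sign of `z.im` undoes the conjugation in `x - i y`.
  have h1 := norm_gaborTransform_eq h (z.re, -z.im)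
  have h2 : ((z.re : ℂ) - Complex.I * ((-z.im : ℝ) : ℂ)) = z := by
    apply Complex.ext <;> simp
  rw [gaborTransform_eq_bargmann, gaborTransform_eq_bargmann, norm_mul, norm_mul, h2] at h1
  exact mul_left_cancel₀ (norm_ne_zero_iff.2 (Complex.exp_ne_zero _)) h1

theorem eq_zero_of_gaborTransform_eq_zero {f : L2R} (h : ∀ p, gaborTransform f p = 0) :
    f = 0 := by
  have h0 : (gaborMagnitude f).1 = 0 := by
    apply Lp.ext
    filter_upwards [gaborMagnitude_ae_eq f, Lp.coeFn_zero ℝ 2 (volume : Measure (ℝ × ℝ))]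
      with p hp h0
    rw [hp, h0, h, norm_zero, Pi.zero_apply]
  have h1 := norm_gaborMagnitude f
  rw [h0, norm_zero, eq_comm, mul_eq_zero, or_iff_left windowNorm_pos.ne', norm_eq_zero] at h1
  exact h1

theorem exists_smul_eq_of_gaborMagnitude_eq {f g : L2R}
    (h : gaborMagnitude f = gaborMagnitude g) : ∃ τ : Circle, f = τ • g := by
  obtain ⟨τ, hτ⟩ := exists_unimodular_of_norm_eq (differentiable_bargmann f)
    (differentiable_bargmann g) (norm_bargmann_eq h)
  refine ⟨τ, sub_eq_zero.1 (eq_zero_of_gaborTransform_eq_zero fun p => ?_)⟩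
  have e : gaborTransform f p = τ * gaborTransform g p := by
    rw [gaborTransform_eq_bargmann, gaborTransform_eq_bargmann, hτ]; ring
  rw [Circle.smul_def, gaborTransform_eq_inner, inner_sub_right, inner_smul_right,
    ← gaborTransform_eq_inner, ← gaborTransform_eq_inner, e, sub_self]

theorem injective_gaborOperator : Function.Injective gaborOperator := by
  intro c d
  induction c using L2ModPhase.ind with | h f => ?_
  induction d using L2ModPhase.ind with | h g => ?_
  intro h
  obtain ⟨τ, hτ⟩ := exists_smul_eq_of_gaborMagnitude_eq (f := f) (g := g) h
  exact Quotient.sound ⟨τ, hτ.symm⟩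

/-! ### Topological properties of the operator -/

theorem continuous_mk : Continuous L2ModPhase.mk := by
  refine (LipschitzWith.mk_one fun f g => ?_).continuous
  have := phaseDist_le f g 1
  rwa [one_smul, ← dist_eq_norm] at this

theorem weaklySeqClosed_gaborOperator : WeaklySeqClosed gaborOperator := by
  rintro c c₀ v ⟨f, f₀, hf, rfl, hlim⟩ hv
  obtain rfl : (fun n => L2ModPhase.mk (f n)) = c := funext hf
  exact Subtype.ext (gaborMagnitude_eq_of_tendsto_weakly (tendsto_toWeakSpace_iff.1 hlim)
    (tendsto_toWeakSpace_iff.1 hv))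

theorem exists_subseq_tendsto_of_tendsto_gaborOperator {c : ℕ → L2ModPhase} {v : L2R2}
    (h : Tendsto (fun n => (gaborOperator (c n)).1) atTop (𝓝 v)) :
    ∃ (d : L2ModPhase) (φ : ℕ → ℕ), StrictMono φ ∧ Tendsto (fun n => c (φ n)) atTop (𝓝 d) ∧
      (gaborOperator d).1 = v := by
  choose f hf using fun n => Quotient.exists_rep (c n)
  obtain rfl : (fun n => L2ModPhase.mk (f n)) = c := funext hf
  obtain ⟨g, φ, hφ, hg, hgv⟩ := exists_subseq_tendsto_of_tendsto_gaborMagnitude h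
  exact ⟨L2ModPhase.mk g, φ, hφ, (continuous_mk.tendsto g).comp hg, hgv⟩

theorem isClosed_range_gaborOperator :
    IsClosed (Set.range fun c => (gaborOperator c : L2R2)) := by
  refine IsSeqClosed.isClosed fun u v hu huv => ?_
  choose c hc using hu
  obtain rfl : (fun n => (gaborOperator (c n) : L2R2)) = u := funext hc
  obtain ⟨d, -, -, -, hd⟩ := exists_subseq_tendsto_of_tendsto_gaborOperator huv
  exact ⟨d, hd⟩

/-- Every subsequence has a further subsequence converging to some `d` with the same image as `c₀`,
and injectivity gives `d = c₀`. -/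
theorem tendsto_of_tendsto_gaborOperator {c : ℕ → L2ModPhase} {c₀ : L2ModPhase}
    (h : Tendsto (fun n => gaborOperator (c n)) atTop (𝓝 (gaborOperator c₀))) :
    Tendsto c atTop (𝓝 c₀) := by
  refine tendsto_of_subseq_tendsto fun ns hns => ?_
  obtain ⟨d, φ, -, hd, hdv⟩ := exists_subseq_tendsto_of_tendsto_gaborOperator
    (((continuous_subtype_val.tendsto _).comp h).comp hns)
  exact ⟨φ, injective_gaborOperator (Subtype.ext hdv) ▸ hd⟩

theorem continuous_symm_ofInjective_gaborOperator :
    Continuous (Equiv.ofInjective gaborOperator injective_gaborOperator).symm := by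
  refine continuous_iff_seqContinuous.2 fun u v huv => ?_
  refine tendsto_of_tendsto_gaborOperator ?_
  simp only [Function.comp_apply, Equiv.apply_ofInjective_symm]
  exact (continuous_subtype_val.tendsto v).comp huv

end GaborPhase

theorem mainTheorem8 :
    GaborPhase.WeaklySeqClosed GaborPhase.gaborOperator ∧
    IsClosed (Set.range fun c => (GaborPhase.gaborOperator c : GaborPhase.L2R2)) ∧
    ∃ hinj : Function.Injective GaborPhase.gaborOperator,
      Continuous (Equiv.ofInjective GaborPhase.gaborOperator hinj).symm :=
  ⟨GaborPhase.weaklySeqClosed_gaborOperator, GaborPhase.isClosed_range_gaborOperator,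
    GaborPhase.injective_gaborOperator, GaborPhase.continuous_symm_ofInjective_gaborOperator⟩
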